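/- Let $\mathbb{T}^{2n}=(\mathbb{R}/\mathbb{Z})^{2n}$ with coordinates $(p_1,q_1,\dots,p_n,q_n)$ and $\omega_{\mathrm{std}}=\sum_{i=1}^n dp_i\wedge dq_i$, and let $S^1=\mathbb{R}/\mathbb{Z}$. For a free homotopy class $\alpha\in[S^1,\mathbb{T}^{2n}]$ let $\mathcal{L}_\alpha\mathbb{T}^{2n}$ be the set of smooth loops $S^1\to\mathbb{T}^{2n}$ representing $\alpha$, with the $C^\infty$ topology, and let $\alpha^k$ be the $k$-fold iterate of $\alpha$, i.e. the class of $t\mapsto x(kt)$ for $x$ representing $\alpha$. For $A\in\pi_1(\mathcal{L}_\alpha\mathbb{T}^{2n},z)$ let $\langle\overline{[\omega_{\mathrm{std}}]},A\rangle=\int_{S^1\times S^1}u^*\omega_{\mathrm{std}}\in\mathbb{R}$, where $u\colon S^1\times S^1\to\mathbb{T}^{2n}$ is a smooth map such that the loop $s\mapsto u(s,\cdot)$ in $\mathcal{L}_\alpha\mathbb{T}^{2n}$ is based at $z$ and represents $A$, and let $\langle\overline{[\omega_{\mathrm{std}}]},\pi_1(\mathcal{L}_\alpha\mathbb{T}^{2n})\rangle\subset\mathbb{R}$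 be the set of these values. Call $e\in\mathbb{Z}^{2n}$ primitive if $e\ne kf$ for all positive integers $k$ and all $f\in\mathbb{Z}^{2n}\setminus\{e\}$. Sending $a\in\mathbb{Z}^{2n}$ to the class of $t\mapsto ta$ is a bijection $\mathbb{Z}^{2n}\cong[S^1,\mathbb{T}^{2n}]$. Every $\mathcal{L}_\alpha\mathbb{T}^{2n}$ is non-empty, and every $\alpha$ can be written as $\alpha=h_\alpha e_\alpha$, where $h_\alpha$ is a positive integer and $e_\alpha\in\mathbb{Z}^{2n}$ is primitive if $\alpha$ is non-trivial, and $h_\alpha=0$, $e_\alpha=0$ if $\alpha$ is trivial. The pairing above is well defined: every $A$ has a representative $u$, and the integral does not depend on the choice of $u$. For every $\alpha$, every base point $z\in\mathcal{L}_\alpha\mathbb{T}^{2n}$ and all $h_\alpha$, $e_\alpha=(e_1,\dots,e_{2n})$ as above, $$\langle\overline{[\omega_{\mathrm{std}}]},\pi_1(\mathcal{L}_\alpha\mathbb{T}^{2n})\rangle =h_\alpha\Bigl\{\sum_{i=1}^n\begin{vmatrix}e_{2i-1}&b_{2i-1}\\ e_{2i}&b_{2i}\end{vmatrix} \Bigm|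 (b_1,\dots,b_{2n})\in\mathbb{Z}^{2n}\Bigr\}=h_\alpha\mathbb{Z}.$$ Consequently $$\langle\overline{[\omega_{\mathrm{std}}]},\pi_1(\mathcal{L}_{\alpha^k}\mathbb{T}^{2n})\rangle=k\,\langle\overline{[\omega_{\mathrm{std}}]},\pi_1(\mathcal{L}_{\alpha}\mathbb{T}^{2n})\rangle$$ for all $\alpha\in[S^1,\mathbb{T}^{2n}]$, all integers $k\ge 0$ and all base points. In particular $\omega_{\mathrm{std}}$ is $\alpha$-toroidally rational for every $\alpha$, i.e. $\langle\overline{[\omega_{\mathrm{std}}]},\pi_1(\mathcal{L}_\alpha\mathbb{T}^{2n})\rangle$ is a discrete subset of $\mathbb{R}$. -/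

import Mathlib

open scoped ContDiff Pointwise

/-- The circle `S¹ = ℝ/ℤ` is Mathlib's `UnitAddCircle`, and the torus `(ℝ/ℤ)^m` is Mathlib's
`UnitAddTorus (Fin m)`, that is `Fin m → UnitAddCircle`. -/
abbrev Torus (m : ℕ) : Type := UnitAddTorus (Fin m)

/-- The standard embedding `ℝ/ℤ → ℂ`, `x ↦ exp (2πix)`. It is a diffeomorphism onto the unit
circle, so it determines the smooth structure of `ℝ/ℤ`. -/
noncomputable def circleEmb (x : UnitAddCircle) : ℂ := (AddCircle.toCircle x : ℂ)

theorem continuous_circleEmb : Continuous circleEmb :=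
  continuous_subtype_val.comp AddCircle.continuous_toCircle

theorem circleEmb_coe (x : ℝ) :
    circleEmb (x : UnitAddCircle) = Complex.exp ((2 * Real.pi * x : ℝ) * Complex.I) := by
  simp [circleEmb, AddCircle.toCircle_apply_mk, Circle.coe_exp]

/-- A map from a normed space to the torus is smooth if all its coordinates are smooth as maps to
the unit circle in `ℂ`. -/
def IsSmooth {E : Type*} [NormedAddCommGroup E] [NormedSpace ℝ E] {m : ℕ}
    (f : E → Torus m) : Prop :=
  ∀ j, ContDiff ℝ ∞ (fun x => circleEmb (f x j))

/-- The derivative of a curve in `ℝ/ℤ`, as an element of the tangent space `ℝ` of `ℝ/ℤ`: if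
`z = exp (2πiθ)` then `θ' = Im (z' * conj z) / 2π`, see `circleDeriv_coe`. -/
noncomputable def circleDeriv (c : ℝ → UnitAddCircle) (t : ℝ) : ℝ :=
  (deriv (fun τ => circleEmb (c τ)) t * (starRingEnd ℂ) (circleEmb (c t))).im / (2 * Real.pi)

/-- The derivative of `t ↦ θ t mod 1` is `θ'`. -/
theorem circleDeriv_coe (θ : ℝ → ℝ) (t : ℝ) (hθ : DifferentiableAt ℝ θ t) :
    circleDeriv (fun τ => (θ τ : UnitAddCircle)) t = deriv θ t := by
  have h1 : HasDerivAt (fun τ => circleEmb (θ τ : UnitAddCircle))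
      (Complex.exp ((2 * Real.pi * θ t : ℝ) * Complex.I) *
        ((2 * Real.pi * deriv θ t : ℝ) * Complex.I)) t := by
    simp only [circleEmb_coe]
    exact (((hθ.hasDerivAt.const_mul (2 * Real.pi)).ofReal_comp).mul_const Complex.I).cexp
  have h2 : Complex.exp ((2 * Real.pi * θ t : ℝ) * Complex.I) *
      (starRingEnd ℂ) (Complex.exp ((2 * Real.pi * θ t : ℝ) * Complex.I)) = 1 := by
    rw [Complex.mul_conj, Complex.normSq_eq_norm_sq, Complex.norm_exp_ofReal_mul_I]
    simp
  unfold circleDeriv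
  rw [h1.deriv, circleEmb_coe, mul_right_comm, h2, one_mul]
  have h3 : 2 * Real.pi ≠ 0 := by positivity
  rw [Complex.im_ofReal_mul, Complex.I_im, mul_one, mul_div_cancel_left₀ _ h3]

/-- The velocity of a curve in the torus, in the tangent space `ℝ^m`. -/
noncomputable def torusDeriv {m : ℕ} (c : ℝ → Torus m) (t : ℝ) : Fin m → ℝ :=
  fun j => circleDeriv (fun τ => c τ j) t

/-! ### The standard symplectic form -/

/-- The `0`-based index of the coordinate `p_i` (the `(2i-1)`-st coordinate). -/
def pIdx {n : ℕ} (i : Fin n) : Fin (2 * n) := ⟨2 * i, by omega⟩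

/-- The `0`-based index of the coordinate `q_i` (the `2i`-th coordinate). -/
def qIdx {n : ℕ} (i : Fin n) : Fin (2 * n) := ⟨2 * i + 1, by omega⟩

/-- The standard symplectic form `∑ dp_i ∧ dq_i`; all tangent spaces of `(ℝ/ℤ)^(2n)` are identified
with `ℝ^(2n)` by translation, and the form is translation invariant. -/
def omegaStd {n : ℕ} (v w : Fin (2 * n) → ℝ) : ℝ :=
  ∑ i : Fin n, (v (pIdx i) * w (qIdx i) - v (qIdx i) * w (pIdx i))

/-! ### Free homotopy classes -/

/-- Free homotopy of loops `S¹ → (ℝ/ℤ)^m`. -/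
instance freeHomotopySetoid (m : ℕ) : Setoid C(UnitAddCircle, Torus m) where
  r := ContinuousMap.Homotopic
  iseqv := ContinuousMap.Homotopic.equivalence

/-- The set `[S¹, (ℝ/ℤ)^m]` of free homotopy classes of loops. -/
def FreeHomotopyClass (m : ℕ) : Type := Quotient (freeHomotopySetoid m)

/-- The free homotopy class of a loop. -/
def freeClass {m : ℕ} (γ : C(UnitAddCircle, Torus m)) : FreeHomotopyClass m :=
  Quotient.mk (freeHomotopySetoid m) γ

/-- The class of constant loops. -/
def trivialClass (m : ℕ) : FreeHomotopyClass m := freeClass (ContinuousMap.const _ 0)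

/-- The class of the linear loop `t ↦ t a` for `a ∈ ℤ^m`. -/
def linearClass {m : ℕ} (a : Fin m → ℤ) : FreeHomotopyClass m :=
  freeClass ⟨fun t j => a j • t, by fun_prop⟩

/-- The `k`-fold iterate `α^k`, the class of `t ↦ γ (k t)` where `γ` represents `α`. -/
def iterateClass {m : ℕ} (α : FreeHomotopyClass m) (k : ℕ) : FreeHomotopyClass m :=
  Quotient.map (sa := freeHomotopySetoid m) (sb := freeHomotopySetoid m)
    (fun γ => γ.comp ⟨fun t => k • t, by fun_prop⟩)
    (fun _ _ h => ContinuousMap.Homotopic.comp h (ContinuousMap.Homotopic.refl _)) α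

/-- `e` is primitive if `e ≠ k f` for all positive integers `k` and all `f ≠ e`. -/
def IsPrimitive {m : ℕ} (e : Fin m → ℤ) : Prop :=
  ∀ k : ℕ, 0 < k → ∀ f : Fin m → ℤ, f ≠ e → e ≠ k • f

/-- `α = h e` under `ℤ^m ≅ [S¹, (ℝ/ℤ)^m]`, where `h` is a positive integer and `e` is primitive if
`α` is non-trivial, and `h = 0`, `e = 0` if `α` is trivial. -/
def IsPrimitiveDecomposition {m : ℕ} (α : FreeHomotopyClass m) (h : ℕ) (e : Fin m → ℤ) : Prop :=
  α = linearClass (h • e) ∧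
    ((α ≠ trivialClass m ∧ 0 < h ∧ IsPrimitive e) ∨ (α = trivialClass m ∧ h = 0 ∧ e = 0))

/-! ### The free loop space -/

/-- Smooth loops `S¹ → (ℝ/ℤ)^m`. -/
structure SmoothLoop (m : ℕ) where
  toMap : C(UnitAddCircle, Torus m)
  smooth : IsSmooth (fun t : ℝ => toMap (t : UnitAddCircle))

/-- The `k`-th derivative of the `j`-th coordinate of a smooth loop, the coordinate being regarded
as a (`1`-periodic) map to the unit circle in `ℂ`. -/
noncomputable def SmoothLoop.jet {m : ℕ} (k : ℕ) (j : Fin m) (γ : SmoothLoop m) : C(ℝ, ℂ) where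
  toFun := iteratedDeriv k (fun t : ℝ => circleEmb (γ.toMap (t : UnitAddCircle) j))
  continuous_toFun := (γ.smooth j).continuous_iteratedDeriv k (by exact_mod_cast le_top)

/-- The `C^∞` topology on the loop space: uniform convergence of all derivatives. (Locally uniform
convergence on `ℝ` is uniform convergence, by periodicity.) -/
noncomputable instance (m : ℕ) : TopologicalSpace (SmoothLoop m) :=
  ⨅ (k : ℕ) (j : Fin m), TopologicalSpace.induced (SmoothLoop.jet k j) inferInstance

/-- The component of the loop space that consists of the loops representing `α`, with the subspace
topology. -/
abbrev LoopComponent {m : ℕ} (α : FreeHomotopyClass m) : Type :=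
  {γ : SmoothLoop m // freeClass γ.toMap = α}

/-! ### The pairing of the symplectic form with the fundamental group of the loop space -/

/-- Smooth maps `S¹ × S¹ → (ℝ/ℤ)^m`. -/
structure SmoothToroid (m : ℕ) where
  toFun : UnitAddCircle × UnitAddCircle → Torus m
  smooth : IsSmooth (fun x : ℝ × ℝ => toFun ((x.1 : UnitAddCircle), (x.2 : UnitAddCircle)))

/-- The integral `∫_{S¹ × S¹} u^* ω_std`. -/
noncomputable def SmoothToroid.integral {n : ℕ} (u : SmoothToroid (2 * n)) : ℝ :=
  ∫ s in (0 : ℝ)..1, ∫ t in (0 : ℝ)..1,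
    omegaStd
      (torusDeriv (fun σ : ℝ => u.toFun ((σ : UnitAddCircle), (t : UnitAddCircle))) s)
      (torusDeriv (fun τ : ℝ => u.toFun ((s : UnitAddCircle), (τ : UnitAddCircle))) t)

/-- `u` represents `A ∈ π₁(L_α, z)` if `s ↦ u (s, ·)` is a loop in `L_α` based at `z` whose homotopy
class is `A`. -/
def SmoothToroid.Represents {m : ℕ} {α : FreeHomotopyClass m} {z : LoopComponent α}
    (u : SmoothToroid m) (A : FundamentalGroup (LoopComponent α) z) : Prop :=
  ∃ p : Path z z,
    (∀ (s : unitInterval) (t : UnitAddCircle),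
      (p s).1.toMap t = u.toFun (((s : ℝ) : UnitAddCircle), t)) ∧
    FundamentalGroup.fromPath (Path.Homotopic.Quotient.mk p) = A

open Classical in
/-- The value of the class in `H¹(L (ℝ/ℤ)^(2n); ℝ)` defined by `ω_std` on `A ∈ π₁(L_α, z)`: the
integral of `ω_std` over a smooth map `S¹ × S¹ → (ℝ/ℤ)^(2n)` representing `A`. -/
noncomputable def omegaBar {n : ℕ} {α : FreeHomotopyClass (2 * n)} {z : LoopComponent α}
    (A : FundamentalGroup (LoopComponent α) z) : ℝ :=
  if h : ∃ u : SmoothToroid (2 * n), u.Represents A then h.choose.integral else 0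

/-- The set of the values of `ω_std` on `π₁(L_α, z)`. -/
noncomputable def omegaPeriods {n : ℕ} {α : FreeHomotopyClass (2 * n)} (z : LoopComponent α) :
    Set ℝ :=
  Set.range (fun A : FundamentalGroup (LoopComponent α) z => omegaBar A)

/-!
Everything is read off lifts to `ℝ^m`. Two loops with lifts of the same winding vector are joined
by the straight line between the lifts, so the winding vector classifies loops up to free homotopy.
The same line, taken in the space of loops, deforms a based loop `s ↦ x_s` in `L_α` to a
translation loop `s ↦ z + s b`; hence `π₁(L_α, z)` is exhausted by the vectors `b ∈ ℤ^m`.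

Integrating `u^*ω` by parts over the period square of a lift shows that it depends only on the
winding vectors `b` and `a` of `u` in the two directions: it is `ω(b, a)`. If `a = h e` with `e`
primitive, the values `ω(e, b)` form the ideal of `ℤ` generated by the coordinates of `e`, which
is `ℤ` since a common divisor of the coordinates could be split off; so the periods are `h ℤ`.
-/

/-! ### Lifting to the universal covering -/

section Lifting

open unitInterval

instance contractibleSpace_unitInterval : ContractibleSpace I :=
  (convex_Icc (0 : ℝ) 1).contractibleSpace ⟨0, unitInterval.zero_mem⟩

instance locallyPathConnectedSpace_unitInterval : LocallyPathConnectedSpace I :=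
  (isQuotientMap_projIcc (h := zero_le_one' ℝ)).locallyPathConnectedSpace

variable {m : ℕ}

/-- The inclusion `ℤ^m → ℝ^m`. -/
def intVec : (Fin m → ℤ) →+ (Fin m → ℝ) := (Int.castAddHom ℝ).compLeft (Fin m)

theorem intVec_apply (a : Fin m → ℤ) (j : Fin m) : intVec a j = a j := rfl

theorem intVec_injective : Function.Injective (intVec : (Fin m → ℤ) → Fin m → ℝ) :=
  Int.cast_injective.comp_left

/-- The universal covering `ℝ^m → (ℝ/ℤ)^m`. -/
def torusMk : (Fin m → ℝ) →+ Torus m where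
  toFun v j := (v j : UnitAddCircle)
  map_zero' := rfl
  map_add' _ _ := rfl

theorem torusMk_apply (v : Fin m → ℝ) (j : Fin m) : torusMk v j = (v j : UnitAddCircle) := rfl

@[fun_prop]
theorem continuous_torusMk : Continuous (torusMk : (Fin m → ℝ) → Torus m) :=
  continuous_pi fun j => (AddCircle.continuous_mk' 1).comp (continuous_apply j)

theorem torusMk_eq_zero_iff {v : Fin m → ℝ} : torusMk v = 0 ↔ ∃ c, intVec c = v := by
  simp only [funext_iff, torusMk_apply, Pi.zero_apply, AddCircle.coe_eq_zero_iff, zsmul_eq_mul,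
    mul_one, intVec_apply, Classical.skolem]

theorem torusMk_intVec (c : Fin m → ℤ) : torusMk (intVec c) = 0 :=
  torusMk_eq_zero_iff.2 ⟨c, rfl⟩

variable {X : Type*} [TopologicalSpace X]

theorem exists_torus_lift [SimplyConnectedSpace X] [LocallyPathConnectedSpace X]
    (f : C(X, Torus m)) :
    ∃ F : C(X, Fin m → ℝ), ∀ x, torusMk (F x) = f x := by
  let x₀ : X := Classical.arbitrary X
  have lift_coordinate : ∀ j, ∃ F : C(X, ℝ), ∀ x, (F x : UnitAddCircle) = f x j := by
    intro j
    obtain ⟨y₀, hy₀⟩ := QuotientAddGroup.mk_surjective (f x₀ j)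
    obtain ⟨F, ⟨-, hF⟩, -⟩ := (AddCircle.isCoveringMap_coe (1 : ℝ)).existsUnique_continuousMap_lifts
      ⟨fun x => f x j, by fun_prop⟩ x₀ y₀ hy₀
    exact ⟨F, congrFun hF⟩
  choose F hF using lift_coordinate
  exact ⟨ContinuousMap.pi F, fun x => funext fun j => hF j x⟩

theorem exists_eq_add_intVec_of_lifts [ConnectedSpace X] {F G : X → Fin m → ℝ}
    (hF : Continuous F) (hG : Continuous G) (h : ∀ x, torusMk (F x) = torusMk (G x)) :
    ∃ c : Fin m → ℤ, ∀ x, F x = G x + intVec c := by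
  have : ∀ x, ∃ c, intVec c = F x - G x := fun x =>
    torusMk_eq_zero_iff.1 (by rw [map_sub, h, sub_self])
  choose c hc using this
  have hcont : Continuous c := continuous_pi fun j => by
    rw [Int.isClosedEmbedding_coe_real.isInducing.continuous_iff]
    exact ((continuous_apply j).comp (hF.sub hG)).congr fun x => (congrFun (hc x) j).symm
  have hconst := fun x y => isPreconnected_univ.constant hcont.continuousOn
    (Set.mem_univ x) (Set.mem_univ y)
  exact ⟨c (Classical.arbitrary X), fun x => by rw [← hconst x, hc, add_sub_cancel]⟩

theorem sub_eq_sub_of_lifts [ConnectedSpace X] {F G : X → Fin m → ℝ} (hF : Continuous F)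
    (hG : Continuous G) (h : ∀ x, torusMk (F x) = torusMk (G x)) (x y : X) :
    F x - F y = G x - G y := by
  obtain ⟨c, hc⟩ := exists_eq_add_intVec_of_lifts hF hG h
  rw [hc, hc, add_sub_add_right_eq_sub]

theorem sub_eq_sub_of_homotopy {H : C(I × I, Torus m)} (hH : ∀ r, H (r, 0) = H (r, 1))
    {Γ Γ' : I → Fin m → ℝ} (hΓ : Continuous Γ) (hΓ' : Continuous Γ')
    (h0 : ∀ s, torusMk (Γ s) = H (0, s)) (h1 : ∀ s, torusMk (Γ' s) = H (1, s)) :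
    Γ 1 - Γ 0 = Γ' 1 - Γ' 0 := by
  obtain ⟨Φ, hΦ⟩ := exists_torus_lift H
  calc
    Γ 1 - Γ 0 = Φ (0, 1) - Φ (0, 0) :=
      sub_eq_sub_of_lifts hΓ (by fun_prop) (fun s => (h0 s).trans (hΦ (0, s)).symm) 1 0
    _ = Φ (1, 1) - Φ (1, 0) := by
      rw [sub_eq_sub_iff_sub_eq_sub]
      exact sub_eq_sub_of_lifts (F := fun r => Φ (r, 1)) (G := fun r => Φ (r, 0)) (by fun_prop)
        (by fun_prop) (fun r => by rw [hΦ, hΦ, hH]) 0 1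
    _ = Γ' 1 - Γ' 0 :=
      (sub_eq_sub_of_lifts hΓ' (by fun_prop) (fun s => (h1 s).trans (hΦ (1, s)).symm) 1 0).symm

end Lifting

/-! ### Winding vectors -/

section Winding

open unitInterval

variable {m : ℕ}

/-- The vector `a ∈ ℤ^m ≅ π₁((ℝ/ℤ)^m)` by which a lift of the loop `γ` to `ℝ^m` changes over a
period. It is unique, see `HasWinding.unique`. -/
def HasWinding (γ : C(UnitAddCircle, Torus m)) (a : Fin m → ℤ) : Prop :=
  ∃ Γ : C(ℝ, Fin m → ℝ), (∀ t : ℝ, torusMk (Γ t) = γ t) ∧ ∀ t, Γ (t + 1) = Γ t + intVec a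

/-- The loop `t ↦ t a`, representing `linearClass a`. -/
def linearLoop (a : Fin m → ℤ) : C(UnitAddCircle, Torus m) := ⟨fun t j => a j • t, by fun_prop⟩

theorem linearLoop_coe (a : Fin m → ℤ) (t : ℝ) : linearLoop a t = torusMk (t • intVec a) := by
  funext j
  change a j • (t : UnitAddCircle) = ((t * a j : ℝ) : UnitAddCircle)
  rw [← AddCircle.coe_zsmul, zsmul_eq_mul, mul_comm]

theorem hasWinding_linearLoop (a : Fin m → ℤ) : HasWinding (linearLoop a) a :=
  ⟨⟨fun t => t • intVec a, by fun_prop⟩, fun t => (linearLoop_coe a t).symm,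
    fun t => by rw [ContinuousMap.coe_mk, add_smul, one_smul]⟩

theorem exists_hasWinding (γ : C(UnitAddCircle, Torus m)) : ∃ a, HasWinding γ a := by
  obtain ⟨Γ, hΓ⟩ := exists_torus_lift
    (γ.comp ⟨((↑) : ℝ → UnitAddCircle), AddCircle.continuous_mk' 1⟩)
  obtain ⟨a, ha⟩ := exists_eq_add_intVec_of_lifts (F := fun t => Γ (t + 1)) (G := Γ)
    (by fun_prop) (by fun_prop) fun t => by
      rw [hΓ, hΓ]
      exact congrArg γ (AddCircle.coe_add_period 1 t)
  exact ⟨a, Γ, hΓ, ha⟩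

namespace HasWinding

variable {γ γ' : C(UnitAddCircle, Torus m)} {a a' : Fin m → ℤ}

theorem lift_add_one (h : HasWinding γ a) {Γ : ℝ → Fin m → ℝ} (hΓ : Continuous Γ)
    (hγ : ∀ t : ℝ, torusMk (Γ t) = γ t) (t : ℝ) : Γ (t + 1) = Γ t + intVec a := by
  obtain ⟨Γ', hγ', ha⟩ := h
  rw [← sub_eq_iff_eq_add',
    sub_eq_sub_of_lifts hΓ Γ'.continuous (fun t => (hγ t).trans (hγ' t).symm), ha,
    add_sub_cancel_left]

theorem add_const (h : HasWinding γ a) (v : Fin m → ℝ) :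
    HasWinding (γ + ContinuousMap.const _ (torusMk v)) a := by
  obtain ⟨Γ, hγ, ha⟩ := h
  refine ⟨Γ + ContinuousMap.const _ v, fun t => ?_, fun t => ?_⟩
  · simp only [ContinuousMap.add_apply, ContinuousMap.const_apply, map_add, hγ]
  · simp only [ContinuousMap.add_apply, ContinuousMap.const_apply, ha, add_right_comm]

theorem eq_of_homotopy (h : HasWinding γ a) (h' : HasWinding γ' a') {H : C(I × I, Torus m)}
    (hH : ∀ r, H (r, 0) = H (r, 1)) (h0 : ∀ s : I, γ (s : ℝ) = H (0, s))
    (h1 : ∀ s : I, γ' (s : ℝ) = H (1, s)) : a = a' := by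
  obtain ⟨Γ, hγ, ha⟩ := h
  obtain ⟨Γ', hγ', ha'⟩ := h'
  have hsub := sub_eq_sub_of_homotopy hH (Γ := fun s => Γ s) (Γ' := fun s => Γ' s) (by fun_prop)
    (by fun_prop) (fun s => (hγ s).trans (h0 s)) (fun s => (hγ' s).trans (h1 s))
  have ha₀ := ha 0
  have ha₀' := ha' 0
  rw [zero_add, ← sub_eq_iff_eq_add'] at ha₀ ha₀'
  exact intVec_injective (ha₀.symm.trans (hsub.trans ha₀'))

theorem unique (h : HasWinding γ a) (h' : HasWinding γ' a') (hh : γ.Homotopic γ') : a = a' := by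
  obtain ⟨H⟩ := hh
  refine h.eq_of_homotopy h'
    (H := ⟨fun x => H (x.1, ((x.2 : ℝ) : UnitAddCircle)), by fun_prop⟩)
    (fun r => ?_) (fun s => (H.apply_zero _).symm) fun s => (H.apply_one _).symm
  simp only [ContinuousMap.coe_mk, Set.Icc.coe_zero, Set.Icc.coe_one, AddCircle.coe_zero,
    AddCircle.coe_period]

theorem freeClass_eq (h : HasWinding γ a) : freeClass γ = linearClass a := by
  obtain ⟨Γ, hγ, ha⟩ := h
  have hper : Function.Periodic (fun t => Γ t - t • intVec a) (1 : ℝ) := fun t => by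
    simp only [ha, add_smul, one_smul, add_sub_add_right_eq_sub]
  let V : C(UnitAddCircle, Fin m → ℝ) :=
    ⟨hper.lift, Continuous.quotient_liftOn' (by fun_prop) _⟩
  have hV : ∀ x, γ x = linearLoop a x + torusMk (V x) := fun x => by
    obtain ⟨t, rfl⟩ := QuotientAddGroup.mk_surjective x
    exact (hγ t).symm.trans (by
      rw [linearLoop_coe, ← map_add]
      exact congrArg torusMk (add_sub_cancel _ _).symm)
  refine Quotient.sound (s := freeHomotopySetoid m) (ContinuousMap.Homotopic.symm
    ⟨⟨⟨fun x => linearLoop a x.2 + torusMk ((x.1 : ℝ) • V x.2), by fun_prop⟩, ?_, ?_⟩⟩)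
  · intro x
    simp only [Set.Icc.coe_zero, zero_smul, map_zero, add_zero]
    rfl
  · intro x
    simp only [Set.Icc.coe_one, one_smul, hV]

end HasWinding

theorem linearClass_bijective (m : ℕ) :
    Function.Bijective (linearClass : (Fin m → ℤ) → FreeHomotopyClass m) := by
  refine ⟨fun a b hab => ?_, fun α => ?_⟩
  · exact (hasWinding_linearLoop a).unique (hasWinding_linearLoop b)
      (Quotient.exact (s := freeHomotopySetoid m) hab)
  · obtain ⟨γ, rfl⟩ := Quotient.exists_rep (s := freeHomotopySetoid m) α
    obtain ⟨a, ha⟩ := exists_hasWinding γ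
    exact ⟨a, ha.freeClass_eq.symm⟩

theorem hasWinding_iff_freeClass_eq {γ : C(UnitAddCircle, Torus m)} {a : Fin m → ℤ} :
    HasWinding γ a ↔ freeClass γ = linearClass a := by
  refine ⟨HasWinding.freeClass_eq, fun h => ?_⟩
  obtain ⟨b, hb⟩ := exists_hasWinding γ
  rwa [(linearClass_bijective m).1 (h.symm.trans hb.freeClass_eq)]

theorem iterateClass_linearClass (a : Fin m → ℤ) (k : ℕ) :
    iterateClass (linearClass a) k = linearClass (k • a) :=
  congrArg freeClass <| ContinuousMap.ext fun t => funext fun j =>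
    (smul_comm (a j) k t).trans (smul_assoc k (a j) t).symm

theorem trivialClass_eq_linearClass_zero (m : ℕ) : trivialClass m = linearClass 0 :=
  congrArg freeClass <| ContinuousMap.ext fun t => funext fun _ => (zero_smul ℤ t).symm

end Winding

/-! ### Continuous families of smooth curves -/

section JetContinuous

variable {X Y E F A : Type*} [TopologicalSpace X] [TopologicalSpace Y]
  [NormedAddCommGroup E] [NormedSpace ℝ E] [NormedAddCommGroup F] [NormedSpace ℝ F]
  [NormedRing A] [NormedAlgebra ℝ A]

/-- The curves `f x : ℝ → E` are smooth and depend continuously on `x` in the topology of locally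
uniform convergence of all derivatives. -/
structure JetContinuous (f : X → ℝ → E) : Prop where
  contDiff : ∀ x, ContDiff ℝ ∞ (f x)
  continuous_iteratedDeriv : ∀ k, Continuous fun p : X × ℝ => iteratedDeriv k (f p.1) p.2

namespace JetContinuous

theorem continuous {f : X → ℝ → E} (hf : JetContinuous f) :
    Continuous fun p : X × ℝ => f p.1 p.2 := by
  simpa only [iteratedDeriv_zero] using hf.continuous_iteratedDeriv 0

theorem contDiffAt {f : X → ℝ → E} (hf : JetContinuous f) (k : ℕ) (x : X) (t : ℝ) :
    ContDiffAt ℝ k (f x) t :=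
  (contDiff_infty.1 (hf.contDiff x) k).contDiffAt

theorem differentiable {f : X → ℝ → E} (hf : JetContinuous f) (x : X) : Differentiable ℝ (f x) :=
  (hf.contDiff x).differentiable (by simp)

theorem deriv {f : X → ℝ → E} (hf : JetContinuous f) : JetContinuous fun x => deriv (f x) where
  contDiff x := (contDiff_infty_iff_deriv.1 (hf.contDiff x)).2
  continuous_iteratedDeriv k := by
    simpa only [iteratedDeriv_succ'] using hf.continuous_iteratedDeriv (k + 1)

theorem of_deriv {f : X → ℝ → E} (hf : Continuous fun p : X × ℝ => f p.1 p.2)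
    (hd : ∀ x, Differentiable ℝ (f x)) (h : JetContinuous fun x => _root_.deriv (f x)) :
    JetContinuous f where
  contDiff x := contDiff_infty_iff_deriv.2 ⟨hd x, h.contDiff x⟩
  continuous_iteratedDeriv
    | 0 => by simpa only [iteratedDeriv_zero] using hf
    | k + 1 => by simpa only [iteratedDeriv_succ'] using h.continuous_iteratedDeriv k

theorem const {c : X → E} (hc : Continuous c) : JetContinuous fun x (_ : ℝ) => c x where
  contDiff _ := contDiff_const
  continuous_iteratedDeriv k := by
    simp only [iteratedDeriv_const]
    split_ifs <;> fun_prop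

theorem precomp {f : X → ℝ → E} (hf : JetContinuous f) {φ : Y → X} (hφ : Continuous φ) :
    JetContinuous fun y => f (φ y) where
  contDiff y := hf.contDiff (φ y)
  continuous_iteratedDeriv k := (hf.continuous_iteratedDeriv k).comp (hφ.prodMap continuous_id)

theorem clm_comp (L : E →L[ℝ] F) {f : X → ℝ → E} (hf : JetContinuous f) :
    JetContinuous fun x t => L (f x t) where
  contDiff x := L.contDiff.comp (hf.contDiff x)
  continuous_iteratedDeriv k := by
    induction k generalizing f with
    | zero => simpa only [iteratedDeriv_zero] using! L.continuous.comp hf.continuous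
    | succ k ih =>
      have hd : ∀ x, _root_.deriv (fun t => L (f x t)) = fun t => L (_root_.deriv (f x) t) :=
        fun x => funext fun t => L.hasFDerivAt.comp_hasDerivAt t (hf.differentiable x t).hasDerivAt
          |>.deriv
      simpa only [iteratedDeriv_succ', hd] using ih hf.deriv

theorem add {f g : X → ℝ → E} (hf : JetContinuous f) (hg : JetContinuous g) :
    JetContinuous fun x t => f x t + g x t where
  contDiff x := (hf.contDiff x).add (hg.contDiff x)
  continuous_iteratedDeriv k :=
    ((hf.continuous_iteratedDeriv k).add (hg.continuous_iteratedDeriv k)).congr fun _ =>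
      (iteratedDeriv_fun_add (hf.contDiffAt k _ _) (hg.contDiffAt k _ _)).symm

theorem mul {f g : X → ℝ → A} (hf : JetContinuous f) (hg : JetContinuous g) :
    JetContinuous fun x t => f x t * g x t where
  contDiff x := (hf.contDiff x).mul (hg.contDiff x)
  continuous_iteratedDeriv k := by
    simp only [iteratedDeriv_fun_mul (hf.contDiffAt k _ _) (hg.contDiffAt k _ _)]
    exact continuous_finsetSum _ fun i _ => ((continuous_const.mul
      (hf.continuous_iteratedDeriv i)).mul (hg.continuous_iteratedDeriv (k - i)))

theorem cexp {f : X → ℝ → ℂ} (hf : JetContinuous f) :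
    JetContinuous fun x t => Complex.exp (f x t) where
  contDiff x := (hf.contDiff x).cexp
  continuous_iteratedDeriv k := by
    induction k using Nat.strong_induction_on with
    | _ k ih =>
      cases k with
      | zero => simpa only [iteratedDeriv_zero] using hf.continuous.cexp
      | succ k =>
        have hd : ∀ x, _root_.deriv (fun t => Complex.exp (f x t)) =
            fun t => Complex.exp (f x t) * _root_.deriv (f x) t :=
          fun x => funext fun t => deriv_cexp (hf.differentiable x t)
        have hexp : ∀ x t, ContDiffAt ℝ k (fun t => Complex.exp (f x t)) t :=
          fun x t => (hf.contDiffAt k x t).cexp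
        simp only [iteratedDeriv_succ', hd,
          iteratedDeriv_fun_mul (hexp _ _) (hf.deriv.contDiffAt k _ _)]
        exact continuous_finsetSum _ fun i hi => (continuous_const.mul
          (ih i (Finset.mem_range.1 hi))).mul (hf.deriv.continuous_iteratedDeriv (k - i))

end JetContinuous

end JetContinuous

/-! ### Smoothness of lifts -/

section SmoothLift

variable {E : Type*} [NormedAddCommGroup E] [NormedSpace ℝ E] {m : ℕ}

theorem circleEmb_add (x y : UnitAddCircle) : circleEmb (x + y) = circleEmb x * circleEmb y := by
  simp only [circleEmb, AddCircle.toCircle_add, Circle.coe_mul]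

theorem isInducing_circleEmb : Topology.IsInducing circleEmb := by
  have h : circleEmb = Subtype.val ∘ AddCircle.homeomorphCircle (T := (1 : ℝ)) one_ne_zero :=
    funext fun x => congrArg Subtype.val (AddCircle.homeomorphCircle_apply one_ne_zero x).symm
  rw [h]
  exact Topology.IsInducing.subtypeVal.comp (Homeomorph.isInducing _)

theorem continuous_torus_iff {X : Type*} [TopologicalSpace X] {f : X → Torus m} :
    Continuous f ↔ ∀ j, Continuous fun x => circleEmb (f x j) :=
  continuous_pi_iff.trans (forall_congr' fun _ => isInducing_circleEmb.continuous_iff)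

theorem IsSmooth.continuous {f : E → Torus m} (h : IsSmooth f) : Continuous f :=
  continuous_torus_iff.2 fun j => (h j).continuous

theorem im_log_circleEmb_coe {x : ℝ} (hx : |x| < 1 / 2) :
    (Complex.log (circleEmb x)).im = 2 * Real.pi * x := by
  have him : ((2 * Real.pi * x : ℝ) * Complex.I).im = 2 * Real.pi * x := by simp
  rw [abs_lt] at hx
  rw [circleEmb_coe, Complex.log_exp] <;> rw [him] <;> nlinarith [Real.pi_pos]

theorem contDiff_circleEmb_coe {n : WithTop ℕ∞} : ContDiff ℝ n fun x : ℝ => circleEmb x := by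
  simp only [circleEmb_coe]
  exact ((Complex.ofRealCLM.contDiff.comp (contDiff_const.mul contDiff_id)).mul contDiff_const).cexp

/-- Near `x₀`, the number `2π (f x - f x₀)` is the imaginary part of the principal logarithm. -/
theorem contDiff_circleEmb_coe_iff {n : WithTop ℕ∞} {f : E → ℝ} (hf : Continuous f) :
    (ContDiff ℝ n fun x => circleEmb (f x)) ↔ ContDiff ℝ n f := by
  refine ⟨fun h => contDiff_iff_contDiffAt.2 fun x₀ => ?_, contDiff_circleEmb_coe.comp⟩
  let g : E → ℂ := fun x => circleEmb (f x) * circleEmb ((-f x₀ : ℝ) : UnitAddCircle)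
  have hg : ∀ x, g x = circleEmb ((f x - f x₀ : ℝ) : UnitAddCircle) := fun x => by
    rw [sub_eq_add_neg, AddCircle.coe_add, circleEmb_add]
  have hlog : ContDiffAt ℝ n (fun x => (Complex.log (g x)).im) x₀ := by
    refine Complex.imCLM.contDiff.contDiffAt.comp x₀ (ContDiffAt.comp (g := Complex.log) x₀ ?_
      (h.contDiffAt.mul contDiffAt_const))
    refine (Complex.contDiffAt_log ?_).restrict_scalars ℝ
    change g x₀ ∈ Complex.slitPlane
    rw [hg, sub_self, circleEmb_coe]
    simp
  refine ((contDiffAt_const (c := f x₀)).add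
    (hlog.div_const (2 * Real.pi))).congr_of_eventuallyEq ?_
  filter_upwards [hf.continuousAt.eventually (Metric.ball_mem_nhds (f x₀) one_half_pos)] with x hx
  rw [hg, im_log_circleEmb_coe hx, mul_div_cancel_left₀ _ Real.two_pi_pos.ne', add_sub_cancel]

theorem isSmooth_torusMk_comp_iff {F : E → Fin m → ℝ} (hF : Continuous F) :
    (IsSmooth fun x => torusMk (F x)) ↔ ContDiff ℝ ∞ F := by
  rw [contDiff_pi]
  exact forall_congr' fun j => contDiff_circleEmb_coe_iff ((continuous_apply j).comp hF)

/-- The derivative `θ' = Im (g' * conj g) / 2π` is a polynomial in `g = exp (2πiθ)` and `g'`. -/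
theorem jetContinuous_circleEmb_coe_iff {X : Type*} [TopologicalSpace X] {θ : X → ℝ → ℝ}
    (hθ : Continuous fun p : X × ℝ => θ p.1 p.2) :
    (JetContinuous fun x t => circleEmb (θ x t)) ↔ JetContinuous θ := by
  refine ⟨fun hg => ?_, fun h => ?_⟩
  · have hd : ∀ x, Differentiable ℝ (θ x) := fun x =>
      ((contDiff_circleEmb_coe_iff (hθ.comp (Continuous.prodMk_right x))).1
        (hg.contDiff x)).differentiable (by simp)
    refine JetContinuous.of_deriv hθ hd ?_
    convert (hg.deriv.mul (hg.clm_comp (Complex.conjCLE : ℂ →L[ℝ] ℂ))).clm_comp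
      ((2 * Real.pi)⁻¹ • Complex.imCLM) using 3 with x t
    rw [← circleDeriv_coe _ _ (hd x t), circleDeriv, div_eq_inv_mul]
    rfl
  · convert ((h.clm_comp Complex.ofRealCLM).mul
      (JetContinuous.const (continuous_const (y := 2 * Real.pi * Complex.I)))).cexp using 3 with x t
    rw [circleEmb_coe, Complex.ofRealCLM_apply]
    push_cast
    ring_nf

end SmoothLift

/-! ### The loop space -/

section LoopSpace

variable {X : Type*} [TopologicalSpace X] {m : ℕ}

theorem SmoothLoop.ext_coe {γ γ' : SmoothLoop m} (h : ∀ t : ℝ, γ.toMap t = γ'.toMap t) :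
    γ = γ' := by
  have : γ.toMap = γ'.toMap := ContinuousMap.ext fun x => QuotientAddGroup.induction_on x h
  cases γ
  congr

theorem continuous_smoothLoop_iff {γ : X → SmoothLoop m} :
    Continuous γ ↔ ∀ j, JetContinuous fun x (t : ℝ) => circleEmb ((γ x).toMap t j) := by
  have hjet : Continuous γ ↔ ∀ k j, Continuous fun x => SmoothLoop.jet k j (γ x) := by
    simp only [continuous_iInf_rng, continuous_induced_rng, Function.comp_def]
  rw [hjet]
  refine ⟨fun h j => ⟨fun x => (γ x).smooth j, fun k => ?_⟩, fun h k j => ?_⟩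
  · exact ContinuousMap.continuous_uncurry_of_continuous ⟨_, h k j⟩
  · exact ContinuousMap.continuous_of_continuous_uncurry _ ((h j).continuous_iteratedDeriv k)

theorem SmoothLoop.continuous_eval {γ : X → SmoothLoop m} (h : Continuous γ) :
    Continuous fun p : X × ℝ => (γ p.1).toMap p.2 :=
  continuous_torus_iff.2 fun j => (continuous_smoothLoop_iff.1 h j).continuous

theorem jetContinuous_lift_iff {γ : X → SmoothLoop m} {F : X × ℝ → Fin m → ℝ} (hF : Continuous F)
    (hγ : ∀ x (t : ℝ), torusMk (F (x, t)) = (γ x).toMap t) :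
    (∀ j, JetContinuous fun x t => F (x, t) j) ↔ Continuous γ := by
  rw [continuous_smoothLoop_iff]
  refine forall_congr' fun j => ?_
  rw [← jetContinuous_circleEmb_coe_iff ((continuous_apply j).comp hF)]
  simp only [← hγ, torusMk_apply]

/-- The loop `t ↦ F t mod 1`, with winding vector `a`. -/
def SmoothLoop.ofLift (F : ℝ → Fin m → ℝ) (hF : ContDiff ℝ ∞ F) (a : Fin m → ℤ)
    (ha : ∀ t, F (t + 1) = F t + intVec a) : SmoothLoop m :=
  have hper : Function.Periodic (fun t => torusMk (F t)) (1 : ℝ) := fun t => by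
    simp only [ha, map_add, torusMk_intVec, add_zero]
  { toMap := ⟨hper.lift, (continuous_torusMk.comp hF.continuous).quotient_liftOn' _⟩
    smooth := (isSmooth_torusMk_comp_iff hF.continuous).2 hF }

theorem SmoothLoop.freeClass_ofLift {F : ℝ → Fin m → ℝ} (hF : ContDiff ℝ ∞ F) {a : Fin m → ℤ}
    (ha : ∀ t, F (t + 1) = F t + intVec a) :
    freeClass (SmoothLoop.ofLift F hF a ha).toMap = linearClass a :=
  HasWinding.freeClass_eq ⟨⟨F, hF.continuous⟩, fun _ => rfl, ha⟩

theorem nonempty_loopComponent (α : FreeHomotopyClass m) : Nonempty (LoopComponent α) := by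
  obtain ⟨a, rfl⟩ := (linearClass_bijective m).2 α
  exact ⟨⟨SmoothLoop.ofLift (fun t => t • intVec a) (contDiff_id.smul contDiff_const) a
    fun t => by rw [add_smul, one_smul], SmoothLoop.freeClass_ofLift _ _⟩⟩

theorem exists_loopFamily_of_lift {a : Fin m → ℤ} {F : X × ℝ → Fin m → ℝ} (hF : Continuous F)
    (hjet : ∀ j, JetContinuous fun x t => F (x, t) j)
    (ha : ∀ x t, F (x, t + 1) = F (x, t) + intVec a) :
    ∃ γ : C(X, LoopComponent (linearClass a)), ∀ x (t : ℝ), (γ x).1.toMap t = torusMk (F (x, t)) :=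
  have hsmooth : ∀ x, ContDiff ℝ ∞ fun t => F (x, t) := fun x =>
    contDiff_pi.2 fun j => (hjet j).contDiff x
  ⟨⟨fun x => ⟨.ofLift _ (hsmooth x) a (ha x), SmoothLoop.freeClass_ofLift _ _⟩,
    ((jetContinuous_lift_iff hF fun _ _ => rfl).1 hjet).subtype_mk _⟩, fun _ _ => rfl⟩

end LoopSpace

/-! ### Translations -/

section Translation

variable {m : ℕ}

theorem torusMk_surjective : Function.Surjective (torusMk : (Fin m → ℝ) → Torus m) :=
  QuotientAddGroup.mk_surjective.comp_left

theorem freeClass_add_const (γ : C(UnitAddCircle, Torus m)) (x : Torus m) :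
    freeClass (γ + ContinuousMap.const _ x) = freeClass γ := by
  obtain ⟨a, ha⟩ := exists_hasWinding γ
  obtain ⟨v, rfl⟩ := torusMk_surjective x
  exact (ha.add_const v).freeClass_eq.trans ha.freeClass_eq.symm

/-- The loop `t ↦ γ t + x`. -/
def SmoothLoop.translate (γ : SmoothLoop m) (x : Torus m) : SmoothLoop m where
  toMap := γ.toMap + ContinuousMap.const _ x
  smooth j := by
    simp only [ContinuousMap.add_apply, ContinuousMap.const_apply, Pi.add_apply, circleEmb_add]
    exact (γ.smooth j).mul contDiff_const

theorem SmoothLoop.translate_zero (γ : SmoothLoop m) : γ.translate 0 = γ :=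
  SmoothLoop.ext_coe fun _ => add_zero _

theorem SmoothLoop.continuous_translate :
    Continuous fun p : SmoothLoop m × Torus m => p.1.translate p.2 := by
  refine continuous_smoothLoop_iff.2 fun j => ?_
  simp only [SmoothLoop.translate, ContinuousMap.add_apply, ContinuousMap.const_apply,
    Pi.add_apply, circleEmb_add]
  exact ((continuous_smoothLoop_iff.1 continuous_id j).precomp continuous_fst).mul
    (.const (continuous_circleEmb.comp (by fun_prop)))

theorem linearLoop_zero (b : Fin m → ℤ) : linearLoop b 0 = 0 := by
  funext j
  exact smul_zero (b j)

/-- The loop `s ↦ z + s b` in the loop space; every class in `π₁` is of this form. -/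
def translationPath {α : FreeHomotopyClass m} (z : LoopComponent α) (b : Fin m → ℤ) :
    Path z z where
  toFun s := ⟨z.1.translate (linearLoop b (s : ℝ)), (freeClass_add_const _ _).trans z.2⟩
  continuous_toFun :=
    have h : Continuous fun s : unitInterval => (z.1, linearLoop b (s : ℝ)) := by fun_prop
    (SmoothLoop.continuous_translate.comp h).subtype_mk _
  source' := Subtype.ext <| by
    simp only [Set.Icc.coe_zero, AddCircle.coe_zero, linearLoop_zero, SmoothLoop.translate_zero]
  target' := Subtype.ext <| by
    simp only [Set.Icc.coe_one, AddCircle.coe_period, linearLoop_zero, SmoothLoop.translate_zero]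

/-- The toroid `(s, t) ↦ γ t + s b`, the adjoint of `translationPath`. -/
def translationToroid (γ : SmoothLoop m) (b : Fin m → ℤ) : SmoothToroid m where
  toFun x := γ.toMap x.2 + linearLoop b x.1
  smooth j := by
    simp only [Pi.add_apply, circleEmb_add, linearLoop_coe, torusMk_apply]
    exact ((γ.smooth j).comp contDiff_snd).mul
      (contDiff_circleEmb_coe.comp (contDiff_fst.mul contDiff_const))

theorem translationToroid_represents {α : FreeHomotopyClass m} (z : LoopComponent α)
    (b : Fin m → ℤ) : (translationToroid z.1 b).Represents
      (FundamentalGroup.fromPath (.mk (translationPath z b))) :=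
  ⟨translationPath z b, fun _ _ => rfl, rfl⟩

end Translation

/-! ### Homotopies of loops in the loop space -/

section PathLift

open unitInterval

variable {m : ℕ}

theorem exists_path_lift {α : FreeHomotopyClass m} {z w : LoopComponent α} (p : Path z w) :
    ∃ P : C(I × ℝ, Fin m → ℝ), ∀ s (t : ℝ), torusMk (P (s, t)) = (p s).1.toMap t := by
  obtain ⟨P, hP⟩ := exists_torus_lift
    ⟨_, SmoothLoop.continuous_eval (continuous_subtype_val.comp p.continuous)⟩
  exact ⟨P, fun s t => hP (s, t)⟩

variable {a : Fin m → ℤ} {z w : LoopComponent (linearClass a)}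

theorem path_lift_add_one {p : Path z w} {P : C(I × ℝ, Fin m → ℝ)}
    (hP : ∀ s (t : ℝ), torusMk (P (s, t)) = (p s).1.toMap t) (s : I) (t : ℝ) :
    P (s, t + 1) = P (s, t) + intVec a :=
  (hasWinding_iff_freeClass_eq.2 (p s).2).lift_add_one (Γ := fun t => P (s, t)) (by fun_prop)
    (hP s) t

/-- The straight line homotopy between the lifts descends to the loop space. -/
theorem homotopic_of_lifts {p q : Path z w} {P Q : C(I × ℝ, Fin m → ℝ)}
    (hP : ∀ s (t : ℝ), torusMk (P (s, t)) = (p s).1.toMap t)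
    (hQ : ∀ s (t : ℝ), torusMk (Q (s, t)) = (q s).1.toMap t)
    (h0 : ∀ t, P (0, t) = Q (0, t)) (h1 : ∀ t, P (1, t) = Q (1, t)) : p.Homotopic q := by
  let F : (I × I) × ℝ → Fin m → ℝ := fun x =>
    (1 - (x.1.1 : ℝ)) • P (x.1.2, x.2) + (x.1.1 : ℝ) • Q (x.1.2, x.2)
  have hjet : ∀ j, JetContinuous fun x t => F (x, t) j := fun j =>
    have hPj := (jetContinuous_lift_iff P.continuous hP).2
      (continuous_subtype_val.comp p.continuous) j
    have hQj := (jetContinuous_lift_iff Q.continuous hQ).2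
      (continuous_subtype_val.comp q.continuous) j
    have hr : Continuous fun x : I × I => (x.1 : ℝ) := by fun_prop
    ((JetContinuous.const (continuous_const.sub hr)).mul (hPj.precomp continuous_snd)).add
      ((JetContinuous.const hr).mul (hQj.precomp continuous_snd))
  have hper : ∀ x t, F (x, t + 1) = F (x, t) + intVec a := fun x t => by
    simp only [F, path_lift_add_one hP, path_lift_add_one hQ]
    module
  have hline : ∀ r {v w : Fin m → ℝ}, v = w → (1 - r : ℝ) • v + r • w = v := by
    rintro r v _ rfl
    module
  obtain ⟨H, hH⟩ := exists_loopFamily_of_lift (by fun_prop) hjet hper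
  refine ⟨⟨⟨H, fun s => ?_, fun s => ?_⟩, fun r s hs => ?_⟩⟩ <;>
    refine Subtype.ext <| SmoothLoop.ext_coe fun t => (hH _ t).trans ?_
  · simp only [F, Set.Icc.coe_zero, sub_zero, one_smul, zero_smul, add_zero]
    exact hP s t
  · simp only [F, Set.Icc.coe_one, sub_self, one_smul, zero_smul, zero_add]
    exact hQ s t
  · rcases hs with rfl | rfl
    · exact (congrArg torusMk (hline _ (h0 t))).trans (hP 0 t)
    · exact (congrArg torusMk (hline _ (h1 t))).trans (hP 1 t)

theorem exists_homotopic_translationPath (p : Path z z) :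
    ∃ b, p.Homotopic (translationPath z b) := by
  obtain ⟨P, hP⟩ := exists_path_lift p
  obtain ⟨b, hb⟩ := exists_eq_add_intVec_of_lifts (F := fun t => P (1, t))
    (G := fun t => P (0, t)) (by fun_prop) (by fun_prop)
    fun t => by rw [hP, hP, p.source, p.target]
  refine ⟨b, homotopic_of_lifts (Q := ⟨fun x => P (0, x.2) + (x.1 : ℝ) • intVec b, by fun_prop⟩)
    hP (fun s t => ?_) (fun t => ?_) fun t => ?_⟩
  · rw [ContinuousMap.coe_mk, map_add, hP, p.source, ← linearLoop_coe]
    rfl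
  · simp only [ContinuousMap.coe_mk, Set.Icc.coe_zero, zero_smul, add_zero]
  · simp only [ContinuousMap.coe_mk, Set.Icc.coe_one, one_smul, hb]

theorem exists_fromPath_translationPath (A : FundamentalGroup (LoopComponent (linearClass a)) z) :
    ∃ b, A = FundamentalGroup.fromPath (.mk (translationPath z b)) := by
  obtain ⟨p, hp⟩ := Path.Homotopic.Quotient.mk_surjective (FundamentalGroup.toPath A)
  obtain ⟨b, hb⟩ := exists_homotopic_translationPath p
  refine ⟨b, ?_⟩
  rw [← Path.Homotopic.Quotient.eq.2 hb, hp]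

end PathLift

theorem exists_represents {m : ℕ} {α : FreeHomotopyClass m} {z : LoopComponent α}
    (A : FundamentalGroup (LoopComponent α) z) : ∃ u : SmoothToroid m, u.Represents A := by
  obtain ⟨a, rfl⟩ := (linearClass_bijective m).2 α
  obtain ⟨b, rfl⟩ := exists_fromPath_translationPath A
  exact ⟨_, translationToroid_represents z b⟩

/-! ### The winding vectors of a toroid -/

section ToroidWinding

open unitInterval

namespace SmoothToroid

variable {m : ℕ}

theorem continuous_toFun (u : SmoothToroid m) : Continuous u.toFun := by
  have h : IsOpenQuotientMap ((↑) : ℝ → UnitAddCircle) := QuotientAddGroup.isOpenQuotientMap_mk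
  exact (h.prodMap h).isQuotientMap.continuous_iff.2 u.smooth.continuous

/-- The loop `s ↦ u (s, 0)`. -/
def fstLoop (u : SmoothToroid m) : C(UnitAddCircle, Torus m) :=
  ⟨fun s => u.toFun (s, 0), u.continuous_toFun.comp (by fun_prop)⟩

/-- The loop `t ↦ u (0, t)`. -/
def sndLoop (u : SmoothToroid m) : C(UnitAddCircle, Torus m) :=
  ⟨fun t => u.toFun (0, t), u.continuous_toFun.comp (by fun_prop)⟩

theorem hasWinding_fstLoop_translationToroid (γ : SmoothLoop m) (b : Fin m → ℤ) :
    HasWinding (translationToroid γ b).fstLoop b := by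
  obtain ⟨v, hv⟩ := torusMk_surjective (γ.toMap 0)
  convert (hasWinding_linearLoop b).add_const v using 1
  ext s : 1
  rw [ContinuousMap.add_apply, ContinuousMap.const_apply, hv, add_comm]
  rfl

variable {u u' : SmoothToroid m} {a b b' : Fin m → ℤ}

theorem Represents.hasWinding_sndLoop {z : LoopComponent (linearClass a)}
    {A : FundamentalGroup (LoopComponent (linearClass a)) z} (h : u.Represents A) :
    HasWinding u.sndLoop a := by
  obtain ⟨p, hp, -⟩ := h
  have hz : u.sndLoop = z.1.toMap := ContinuousMap.ext fun t => by
    rw [← p.source, hp]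
    rfl
  exact hz ▸ hasWinding_iff_freeClass_eq.2 z.2

theorem Represents.fstLoop_winding_unique {α : FreeHomotopyClass m} {z : LoopComponent α}
    {A : FundamentalGroup (LoopComponent α) z} (h : u.Represents A) (h' : u'.Represents A)
    (hb : HasWinding u.fstLoop b) (hb' : HasWinding u'.fstLoop b') : b = b' := by
  obtain ⟨p, hp, hpA⟩ := h
  obtain ⟨p', hp', rfl⟩ := h'
  obtain ⟨K⟩ := Path.Homotopic.Quotient.exact hpA
  have hcont : Continuous fun x : I × I => (K x).1.toMap (0 : ℝ) :=
    (SmoothLoop.continuous_eval (continuous_subtype_val.comp K.continuous)).comp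
      (Continuous.prodMk_left 0)
  refine hb.eq_of_homotopy hb' (H := ⟨_, hcont⟩) (fun r => ?_) (fun s => ?_) fun s => ?_
  · simp only [ContinuousMap.coe_mk, Path.Homotopy.source, Path.Homotopy.target]
  · exact (hp s 0).symm.trans (by simp)
  · exact (hp' s 0).symm.trans (by simp)

end SmoothToroid

end ToroidWinding

/-! ### Stokes' theorem -/

section Stokes

variable {D E F G : Type*} [NormedAddCommGroup D] [NormedSpace ℝ D] [NormedAddCommGroup E]
  [NormedSpace ℝ E] [NormedAddCommGroup F] [NormedSpace ℝ F] [NormedAddCommGroup G]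
  [NormedSpace ℝ G]

theorem fderiv_add_of_periodic {f : D → E} {v : D} {c : E} (h : ∀ x, f (x + v) = f x + c) (x : D) :
    fderiv ℝ f (x + v) = fderiv ℝ f x := by
  rw [← fderiv_comp_add_right, funext h, fderiv_add_const]

theorem integral_clm_fderiv_of_periodic [CompleteSpace G] (L : F →L[ℝ] G) {g : D → F}
    (hg : ContDiff ℝ 1 g) {v : D} {c : F} (h : ∀ x, g (x + v) = g x + c) (x : D) :
    ∫ r in (0 : ℝ)..1, L (fderiv ℝ g (x + r • v) v) = L c := by
  have hderiv : ∀ r : ℝ, HasDerivAt (fun r => L (g (x + r • v))) (L (fderiv ℝ g (x + r • v) v)) r :=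
    fun r => L.hasFDerivAt.comp_hasDerivAt r <|
      ((hg.differentiable one_ne_zero _).hasFDerivAt.comp_hasDerivAt r
        (((hasDerivAt_id' r).smul_const v).const_add x)).congr_deriv (by rw [one_smul])
  have := hg.continuous_fderiv one_ne_zero
  rw [intervalIntegral.integral_eq_sub_of_hasDerivAt (fun r _ => hderiv r)
    (Continuous.intervalIntegrable (by fun_prop) _ _), one_smul, zero_smul, add_zero, h, map_add,
    add_sub_cancel_left]

theorem hasFDerivAt_bilin_fderiv (B : E →L[ℝ] F →L[ℝ] G) {f : D → E} {g : D → F} {x : D}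
    (hf : DifferentiableAt ℝ f x) (hg : DifferentiableAt ℝ (fderiv ℝ g) x) (v : D) :
    HasFDerivAt (fun x => B (f x) (fderiv ℝ g x v))
      (B.precompR D (f x) ((fderiv ℝ (fderiv ℝ g) x).flip v) +
        B.precompL D (fderiv ℝ f x) (fderiv ℝ g x v)) x :=
  B.hasFDerivAt_of_bilinear hf.hasFDerivAt
    ((ContinuousLinearMap.apply ℝ F v).hasFDerivAt.comp x hg.hasFDerivAt)

/-- The form `B(df ∧ dg)` is the differential of `B(f, dg)`. -/
theorem integral_bilin_fderiv_wedge (B : E →L[ℝ] F →L[ℝ] G) {f : ℝ × ℝ → E}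
    {g : ℝ × ℝ → F} (hf : ContDiff ℝ 1 f) (hg : ContDiff ℝ 2 g) (a₁ a₂ b₁ b₂ : ℝ) :
    ∫ s in a₁..b₁, ∫ t in a₂..b₂,
      (B (fderiv ℝ f (s, t) (1, 0)) (fderiv ℝ g (s, t) (0, 1)) -
        B (fderiv ℝ f (s, t) (0, 1)) (fderiv ℝ g (s, t) (1, 0))) =
      (∫ t in a₂..b₂, (B (f (b₁, t)) (fderiv ℝ g (b₁, t) (0, 1)) -
        B (f (a₁, t)) (fderiv ℝ g (a₁, t) (0, 1)))) -
      ∫ s in a₁..b₁, (B (f (s, b₂)) (fderiv ℝ g (s, b₂) (1, 0)) -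
        B (f (s, a₂)) (fderiv ℝ g (s, a₂) (1, 0))) := by
  have hg' : ContDiff ℝ 1 (fderiv ℝ g) := hg.fderiv_right (by norm_num)
  have hf₀ := hf.continuous
  have hg₁ := hg'.continuous
  have hderiv := fun v x => hasFDerivAt_bilin_fderiv B (hf.differentiable one_ne_zero x)
    (hg'.differentiable one_ne_zero x) v
  have hdiv : ∀ x : ℝ × ℝ,
      (B.precompR _ (f x) ((fderiv ℝ (fderiv ℝ g) x).flip (0, 1)) +
        B.precompL _ (fderiv ℝ f x) (fderiv ℝ g x (0, 1))) (1, 0) +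
      (-(B.precompR _ (f x) ((fderiv ℝ (fderiv ℝ g) x).flip (1, 0)) +
        B.precompL _ (fderiv ℝ f x) (fderiv ℝ g x (1, 0)))) (0, 1) =
      B (fderiv ℝ f x (1, 0)) (fderiv ℝ g x (0, 1)) -
        B (fderiv ℝ f x (0, 1)) (fderiv ℝ g x (1, 0)) := fun x => by
    simp only [add_apply, neg_apply, ContinuousLinearMap.precompR_apply,
      ContinuousLinearMap.compL_apply, ContinuousLinearMap.comp_apply,
      ContinuousLinearMap.precompL_apply, ContinuousLinearMap.flip_apply,
      (hg.contDiffAt.isSymmSndFDerivAt (by simp)) (1, 0) (0, 1)]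
    abel
  have hstokes := MeasureTheory.integral2_divergence_prod_of_hasFDerivAt
    (fun x => B (f x) (fderiv ℝ g x (0, 1))) (fun x => -B (f x) (fderiv ℝ g x (1, 0))) _ _
    a₁ a₂ b₁ b₂ (Continuous.continuousOn (by fun_prop)) (Continuous.continuousOn (by fun_prop))
    (fun x _ => hderiv (0, 1) x) (fun x _ => (hderiv (1, 0) x).neg) (by
      simp only [hdiv]
      exact (Continuous.continuousOn (by fun_prop)).integrableOn_compact
        (isCompact_uIcc.prod isCompact_uIcc))
  simp only [hdiv] at hstokes
  rw [hstokes, intervalIntegral.integral_sub, intervalIntegral.integral_sub,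
    intervalIntegral.integral_neg, intervalIntegral.integral_neg]
  · abel
  all_goals exact Continuous.intervalIntegrable (by fun_prop) _ _

theorem integral_bilin_fderiv_wedge_of_periodic [CompleteSpace G] (B : E →L[ℝ] F →L[ℝ] G)
    {f : ℝ × ℝ → E} {g : ℝ × ℝ → F} (hf : ContDiff ℝ 1 f) (hg : ContDiff ℝ 2 g)
    {f₁ f₂ : E} {g₁ g₂ : F}
    (hf₁ : ∀ x, f (x + (1, 0)) = f x + f₁) (hf₂ : ∀ x, f (x + (0, 1)) = f x + f₂)
    (hg₁ : ∀ x, g (x + (1, 0)) = g x + g₁) (hg₂ : ∀ x, g (x + (0, 1)) = g x + g₂) :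
    ∫ s in (0 : ℝ)..1, ∫ t in (0 : ℝ)..1,
      (B (fderiv ℝ f (s, t) (1, 0)) (fderiv ℝ g (s, t) (0, 1)) -
        B (fderiv ℝ f (s, t) (0, 1)) (fderiv ℝ g (s, t) (1, 0))) = B f₁ g₂ - B f₂ g₁ := by
  have hside₁ : ∀ t : ℝ, B (f (1, t)) (fderiv ℝ g (1, t) (0, 1)) -
      B (f (0, t)) (fderiv ℝ g (0, t) (0, 1)) =
      B f₁ (fderiv ℝ g ((0, 0) + t • (0, 1)) (0, 1)) := fun t => by
    have hx : ((1, t) : ℝ × ℝ) = (0, t) + (1, 0) := by simp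
    rw [hx, hf₁, fderiv_add_of_periodic hg₁, map_add, add_apply, add_sub_cancel_left]
    simp
  have hside₂ : ∀ s : ℝ, B (f (s, 1)) (fderiv ℝ g (s, 1) (1, 0)) -
      B (f (s, 0)) (fderiv ℝ g (s, 0) (1, 0)) =
      B f₂ (fderiv ℝ g ((0, 0) + s • (1, 0)) (1, 0)) := fun s => by
    have hx : ((s, 1) : ℝ × ℝ) = (s, 0) + (0, 1) := by simp
    rw [hx, hf₂, fderiv_add_of_periodic hg₂, map_add, add_apply, add_sub_cancel_left]
    simp
  have hg' : ContDiff ℝ 1 g := hg.of_le one_le_two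
  simp only [integral_bilin_fderiv_wedge B hf hg, hside₁, hside₂]
  rw [integral_clm_fderiv_of_periodic _ hg' hg₂, integral_clm_fderiv_of_periodic _ hg' hg₁]

end Stokes

/-! ### The integral over a toroid -/

section ToroidIntegral

theorem torusDeriv_torusMk {m : ℕ} {Γ : ℝ → Fin m → ℝ} {v : Fin m → ℝ} {t : ℝ}
    (h : HasDerivAt Γ v t) : torusDeriv (fun τ => torusMk (Γ τ)) t = v :=
  funext fun j =>
    (circleDeriv_coe _ t (hasDerivAt_pi.1 h j).differentiableAt).trans (hasDerivAt_pi.1 h j).deriv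

namespace SmoothToroid

section Lift

variable {m : ℕ} {u : SmoothToroid m} {U : C(ℝ × ℝ, Fin m → ℝ)}

theorem exists_lift (u : SmoothToroid m) :
    ∃ U : C(ℝ × ℝ, Fin m → ℝ), ∀ s t : ℝ, torusMk (U (s, t)) = u.toFun (s, t) := by
  obtain ⟨U, hU⟩ := exists_torus_lift ⟨_, u.smooth.continuous⟩
  exact ⟨U, fun s t => hU (s, t)⟩

theorem contDiff_lift (hU : ∀ s t : ℝ, torusMk (U (s, t)) = u.toFun (s, t)) : ContDiff ℝ ∞ U :=
  (isSmooth_torusMk_comp_iff U.continuous).1 (by simpa only [← hU] using u.smooth)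

theorem lift_add_fst (hU : ∀ s t : ℝ, torusMk (U (s, t)) = u.toFun (s, t)) {b : Fin m → ℤ}
    (hb : HasWinding u.fstLoop b) (x : ℝ × ℝ) : U (x + (1, 0)) = U x + intVec b := by
  have hsub := sub_eq_sub_of_lifts (F := fun x => U (x + (1, 0))) (G := U) (by fun_prop)
    (by fun_prop) (fun ⟨s, t⟩ => by simp [hU]) x (0, 0)
  have h0 := hb.lift_add_one (Γ := fun s => U (s, 0)) (by fun_prop) (fun s => hU s 0) 0
  rw [← sub_eq_iff_eq_add', sub_eq_sub_iff_sub_eq_sub.1 hsub, sub_eq_iff_eq_add']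
  simpa using h0

theorem lift_add_snd (hU : ∀ s t : ℝ, torusMk (U (s, t)) = u.toFun (s, t)) {a : Fin m → ℤ}
    (ha : HasWinding u.sndLoop a) (x : ℝ × ℝ) : U (x + (0, 1)) = U x + intVec a := by
  have hsub := sub_eq_sub_of_lifts (F := fun x => U (x + (0, 1))) (G := U) (by fun_prop)
    (by fun_prop) (fun ⟨s, t⟩ => by simp [hU]) x (0, 0)
  have h0 := ha.lift_add_one (Γ := fun t => U (0, t)) (by fun_prop) (fun t => hU 0 t) 0
  rw [← sub_eq_iff_eq_add', sub_eq_sub_iff_sub_eq_sub.1 hsub, sub_eq_iff_eq_add']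
  simpa using h0

end Lift

end SmoothToroid

/-- The bilinear form `∑ dp_i ⊗ dq_i`, of which `ω_std` is the antisymmetrization. -/
noncomputable def stdBilin (n : ℕ) : (Fin (2 * n) → ℝ) →L[ℝ] (Fin (2 * n) → ℝ) →L[ℝ] ℝ :=
  ∑ i : Fin n, (ContinuousLinearMap.mul ℝ ℝ).bilinearComp
    (ContinuousLinearMap.proj (pIdx i)) (ContinuousLinearMap.proj (qIdx i))

variable {n : ℕ}

theorem omegaStd_eq_stdBilin_sub (v w : Fin (2 * n) → ℝ) :
    omegaStd v w = stdBilin n v w - stdBilin n w v := by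
  simp only [omegaStd, stdBilin, sum_apply, ContinuousLinearMap.bilinearComp_apply,
    ContinuousLinearMap.proj_apply, ContinuousLinearMap.mul_apply', Finset.sum_sub_distrib,
    mul_comm (w _)]

namespace SmoothToroid

theorem integral_eq_omegaStd {u : SmoothToroid (2 * n)} {b a : Fin (2 * n) → ℤ}
    (hb : HasWinding u.fstLoop b) (ha : HasWinding u.sndLoop a) :
    u.integral = omegaStd (intVec b) (intVec a) := by
  obtain ⟨U, hU⟩ := u.exists_lift
  have hsmooth : ContDiff ℝ ∞ U := contDiff_lift hU
  have hfderiv : ∀ x, HasFDerivAt U (fderiv ℝ U x) x := fun x =>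
    (hsmooth.differentiable (by simp) x).hasFDerivAt
  have hfst : ∀ s t : ℝ, torusDeriv (fun σ : ℝ => u.toFun (σ, t)) s = fderiv ℝ U (s, t) (1, 0) :=
    fun s t => by
      simp only [← hU]
      exact torusDeriv_torusMk ((hfderiv _).comp_hasDerivAt s
        ((hasDerivAt_id s).prodMk (hasDerivAt_const s t)))
  have hsnd : ∀ s t : ℝ, torusDeriv (fun τ : ℝ => u.toFun (s, τ)) t = fderiv ℝ U (s, t) (0, 1) :=
    fun s t => by
      simp only [← hU]
      exact torusDeriv_torusMk ((hfderiv _).comp_hasDerivAt t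
        ((hasDerivAt_const t s).prodMk (hasDerivAt_id t)))
  simp only [SmoothToroid.integral, hfst, hsnd, omegaStd_eq_stdBilin_sub]
  exact integral_bilin_fderiv_wedge_of_periodic _ (contDiff_infty.1 hsmooth 1)
    (contDiff_infty.1 hsmooth 2) (lift_add_fst hU hb) (lift_add_snd hU ha) (lift_add_fst hU hb)
    (lift_add_snd hU ha)

theorem Represents.integral_eq_integral {α : FreeHomotopyClass (2 * n)} {z : LoopComponent α}
    {A : FundamentalGroup (LoopComponent α) z} {u u' : SmoothToroid (2 * n)}
    (h : u.Represents A) (h' : u'.Represents A) : u.integral = u'.integral := by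
  obtain ⟨a, rfl⟩ := (linearClass_bijective _).2 α
  obtain ⟨b, hb⟩ := exists_hasWinding u.fstLoop
  obtain ⟨b', hb'⟩ := exists_hasWinding u'.fstLoop
  rw [integral_eq_omegaStd hb h.hasWinding_sndLoop, integral_eq_omegaStd hb' h'.hasWinding_sndLoop,
    h.fstLoop_winding_unique h' hb hb']

theorem Represents.integral_eq_omegaBar {α : FreeHomotopyClass (2 * n)} {z : LoopComponent α}
    {A : FundamentalGroup (LoopComponent α) z} {u : SmoothToroid (2 * n)} (h : u.Represents A) :
    u.integral = omegaBar A := by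
  have hex : ∃ u : SmoothToroid (2 * n), u.Represents A := ⟨u, h⟩
  rw [omegaBar, dif_pos hex]
  exact h.integral_eq_integral hex.choose_spec

end SmoothToroid

theorem omegaBar_translationPath {a : Fin (2 * n) → ℤ} (z : LoopComponent (linearClass a))
    (b : Fin (2 * n) → ℤ) :
    omegaBar (FundamentalGroup.fromPath (.mk (translationPath z b))) =
      omegaStd (intVec b) (intVec a) :=
  have h := translationToroid_represents z b
  h.integral_eq_omegaBar.symm.trans <|
    SmoothToroid.integral_eq_omegaStd (SmoothToroid.hasWinding_fstLoop_translationToroid z.1 b)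
      h.hasWinding_sndLoop

end ToroidIntegral

/-! ### The symplectic form on integer vectors -/

section IntegerValues

variable {n : ℕ}

/-- The standard symplectic form on `ℤ^(2n)`, as a sum of determinants. -/
def omegaInt : (Fin (2 * n) → ℤ) →ₗ[ℤ] (Fin (2 * n) → ℤ) →ₗ[ℤ] ℤ :=
  LinearMap.mk₂ ℤ (fun e b => ∑ i : Fin n, !![e (pIdx i), b (pIdx i); e (qIdx i), b (qIdx i)].det)
    (fun e e' b => by
      simp only [Matrix.det_fin_two_of, Pi.add_apply, ← Finset.sum_add_distrib]
      exact Finset.sum_congr rfl fun i _ => by ring)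
    (fun c e b => by
      simp only [Matrix.det_fin_two_of, Pi.smul_apply, smul_eq_mul, Finset.mul_sum]
      exact Finset.sum_congr rfl fun i _ => by ring)
    (fun e b b' => by
      simp only [Matrix.det_fin_two_of, Pi.add_apply, ← Finset.sum_add_distrib]
      exact Finset.sum_congr rfl fun i _ => by ring)
    (fun c e b => by
      simp only [Matrix.det_fin_two_of, Pi.smul_apply, smul_eq_mul, Finset.mul_sum]
      exact Finset.sum_congr rfl fun i _ => by ring)

theorem omegaInt_apply (e b : Fin (2 * n) → ℤ) :
    omegaInt e b = ∑ i : Fin n, (e (pIdx i) * b (qIdx i) - b (pIdx i) * e (qIdx i)) := by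
  simp only [omegaInt, LinearMap.mk₂_apply, Matrix.det_fin_two_of]

theorem omegaStd_intVec (b a : Fin (2 * n) → ℤ) :
    omegaStd (intVec b) (intVec a) = (omegaInt a (-b) : ℤ) := by
  rw [omegaInt_apply, omegaStd, Int.cast_sum]
  refine Finset.sum_congr rfl fun i _ => ?_
  simp only [intVec_apply, Pi.neg_apply]
  push_cast
  ring

theorem range_omegaInt_smul (k : ℕ) (a : Fin (2 * n) → ℤ) :
    (Set.range fun b => ((omegaInt (k • a) b : ℤ) : ℝ)) =
      (k : ℝ) • Set.range fun b => ((omegaInt a b : ℤ) : ℝ) := by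
  rw [← Set.image_smul, ← Set.range_comp]
  refine congrArg Set.range (funext fun b => ?_)
  rw [map_nsmul, LinearMap.smul_apply, nsmul_eq_mul, Int.cast_mul, Int.cast_natCast,
    Function.comp_apply, smul_eq_mul]

theorem pIdx_injective : Function.Injective (pIdx : Fin n → Fin (2 * n)) := fun i j h => by
  have := Fin.val_eq_of_eq h
  grind [pIdx]

theorem qIdx_injective : Function.Injective (qIdx : Fin n → Fin (2 * n)) := fun i j h => by
  have := Fin.val_eq_of_eq h
  grind [qIdx]

theorem pIdx_ne_qIdx (i j : Fin n) : pIdx i ≠ qIdx j := fun h => by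
  have := Fin.val_eq_of_eq h
  grind [pIdx, qIdx]

theorem exists_eq_pIdx_or_qIdx (j : Fin (2 * n)) : ∃ i : Fin n, j = pIdx i ∨ j = qIdx i := by
  refine ⟨⟨j / 2, by omega⟩, ?_⟩
  simp only [Fin.ext_iff, pIdx, qIdx]
  omega

theorem omegaInt_single_pIdx (e : Fin (2 * n) → ℤ) (i : Fin n) :
    omegaInt e (Pi.single (pIdx i) 1) = -e (qIdx i) := by
  simp [omegaInt_apply, Pi.single_apply, pIdx_injective.eq_iff, (pIdx_ne_qIdx _ _).symm]

theorem omegaInt_single_qIdx (e : Fin (2 * n) → ℤ) (i : Fin n) :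
    omegaInt e (Pi.single (qIdx i) 1) = e (pIdx i) := by
  simp [omegaInt_apply, Pi.single_apply, qIdx_injective.eq_iff, pIdx_ne_qIdx]

theorem coordinate_mem_range_omegaInt (e : Fin (2 * n) → ℤ) (j : Fin (2 * n)) :
    e j ∈ LinearMap.range (omegaInt e) := by
  obtain ⟨i, rfl | rfl⟩ := exists_eq_pIdx_or_qIdx j
  · exact ⟨_, omegaInt_single_qIdx e i⟩
  · exact neg_mem_iff.1 ⟨_, omegaInt_single_pIdx e i⟩

end IntegerValues

/-! ### Primitive vectors -/

section Primitive

variable {m : ℕ}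

theorem IsPrimitive.isUnit_of_forall_dvd {e : Fin m → ℤ} (he : IsPrimitive e) (h0 : e ≠ 0) {d : ℤ}
    (hd : ∀ j, d ∣ e j) : IsUnit d := by
  choose f hf using fun j => Int.natAbs_dvd.2 (hd j)
  have hef : e = d.natAbs • f := funext fun j => by rw [hf, Pi.smul_apply, nsmul_eq_mul]
  have hpos : 0 < d.natAbs := Nat.pos_of_ne_zero fun h => h0 (by rw [hef, h, zero_smul])
  have hfe : f = e := by_contra fun hfe => he _ hpos f hfe hef
  rw [hfe] at hef
  obtain ⟨j, hj⟩ := Function.ne_iff.1 h0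
  have hj' := congrFun hef j
  rw [Pi.smul_apply, nsmul_eq_mul, eq_comm, mul_eq_right₀ hj] at hj'
  exact Int.isUnit_iff_natAbs_eq.2 (by exact_mod_cast hj')

theorem isPrimitive_of_gcd_eq_one {e : Fin m → ℤ} (h : Finset.univ.gcd e = 1) : IsPrimitive e := by
  intro k _ f hf hef
  have hk : (k : ℤ) ∣ 1 := h ▸ Finset.dvd_gcd fun j _ => ⟨f j, by
    rw [hef, Pi.smul_apply, nsmul_eq_mul]⟩
  have hk1 : k = 1 := by exact_mod_cast Int.eq_one_of_dvd_one (Int.natCast_nonneg k) hk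
  exact hf (by rw [hef, hk1, one_smul])

theorem exists_eq_smul_isPrimitive {a : Fin m → ℤ} (ha : a ≠ 0) :
    ∃ (h : ℕ) (e : Fin m → ℤ), 0 < h ∧ IsPrimitive e ∧ a = h • e := by
  obtain ⟨i, -⟩ := Function.ne_iff.1 ha
  obtain ⟨e, he, hgcd⟩ := Finset.extract_gcd a ⟨i, Finset.mem_univ i⟩
  obtain ⟨h, hh⟩ := Int.eq_ofNat_of_zero_le (Int.nonneg_of_normalize_eq_self
    (Finset.normalize_gcd (s := Finset.univ) (f := a)))
  have hae : a = h • e := funext fun j => by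
    rw [he j (Finset.mem_univ j), hh, Pi.smul_apply, nsmul_eq_mul]
  refine ⟨h, e, Nat.pos_of_ne_zero fun h0 => ha ?_, isPrimitive_of_gcd_eq_one hgcd, hae⟩
  rw [hae, h0, zero_smul]

theorem linearClass_eq_trivialClass_iff {a : Fin m → ℤ} :
    linearClass a = trivialClass m ↔ a = 0 := by
  rw [trivialClass_eq_linearClass_zero, (linearClass_bijective m).1.eq_iff]

theorem exists_isPrimitiveDecomposition (α : FreeHomotopyClass m) :
    ∃ (h : ℕ) (e : Fin m → ℤ), IsPrimitiveDecomposition α h e := by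
  obtain ⟨a, rfl⟩ := (linearClass_bijective m).2 α
  rcases eq_or_ne a 0 with rfl | ha
  · exact ⟨0, 0, by rw [smul_zero], Or.inr ⟨linearClass_eq_trivialClass_iff.2 rfl, rfl, rfl⟩⟩
  · obtain ⟨h, e, hh, he, rfl⟩ := exists_eq_smul_isPrimitive ha
    exact ⟨h, e, rfl, Or.inl ⟨mt linearClass_eq_trivialClass_iff.1 ha, hh, he⟩⟩

variable {n : ℕ}

theorem IsPrimitive.omegaInt_surjective {e : Fin (2 * n) → ℤ} (he : IsPrimitive e) (h0 : e ≠ 0) :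
    Function.Surjective (omegaInt e) := by
  obtain ⟨d, hd⟩ := IsPrincipalIdealRing.principal (LinearMap.range (omegaInt e))
  have hdvd : ∀ j, d ∣ e j := fun j =>
    Ideal.mem_span_singleton.1 (hd.le (coordinate_mem_range_omegaInt e j))
  rw [← LinearMap.range_eq_top, hd]
  exact Ideal.span_singleton_eq_top.2 (he.isUnit_of_forall_dvd h0 hdvd)

theorem IsPrimitiveDecomposition.smul_range_omegaInt {α : FreeHomotopyClass (2 * n)} {h : ℕ}
    {e : Fin (2 * n) → ℤ} (H : IsPrimitiveDecomposition α h e) :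
    ((h : ℝ) • Set.range fun b => ((omegaInt e b : ℤ) : ℝ)) =
      (h : ℝ) • Set.range (fun c : ℤ => (c : ℝ)) := by
  obtain ⟨rfl, ⟨hα, -, he⟩ | ⟨-, rfl, -⟩⟩ := H
  · have h0 : e ≠ 0 := fun h0 =>
      hα (linearClass_eq_trivialClass_iff.2 (by rw [h0, smul_zero]))
    exact congrArg _ ((he.omegaInt_surjective h0).range_comp _)
  · rw [Nat.cast_zero, Set.zero_smul_set (Set.range_nonempty _),
      Set.zero_smul_set (Set.range_nonempty _)]

end Primitive

/-! ### The periods -/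

section Periods

variable {n : ℕ} {α : FreeHomotopyClass (2 * n)}

theorem omegaPeriods_eq_range {a : Fin (2 * n) → ℤ} (hα : α = linearClass a)
    (z : LoopComponent α) : omegaPeriods z = Set.range fun b => ((omegaInt a b : ℤ) : ℝ) := by
  subst hα
  refine Set.Subset.antisymm ?_ ?_
  · rintro _ ⟨A, rfl⟩
    obtain ⟨b, rfl⟩ := exists_fromPath_translationPath A
    exact ⟨-b, by beta_reduce; rw [omegaBar_translationPath, omegaStd_intVec]⟩
  · rintro _ ⟨b, rfl⟩
    exact ⟨.fromPath (.mk (translationPath z (-b))),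
      by beta_reduce; rw [omegaBar_translationPath, omegaStd_intVec, neg_neg]⟩

theorem omegaPeriods_iterateClass {k : ℕ} (z : LoopComponent α)
    (w : LoopComponent (iterateClass α k)) : omegaPeriods w = (k : ℝ) • omegaPeriods z := by
  obtain ⟨a, rfl⟩ := (linearClass_bijective _).2 α
  rw [omegaPeriods_eq_range (iterateClass_linearClass a k), omegaPeriods_eq_range rfl,
    range_omegaInt_smul]

theorem discreteTopology_omegaPeriods (z : LoopComponent α) :
    DiscreteTopology (omegaPeriods z) := by
  obtain ⟨a, hα⟩ := (linearClass_bijective _).2 α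
  have hdiscrete : DiscreteTopology (Set.range (Int.cast : ℤ → ℝ)) :=
    Int.isClosedEmbedding_coe_real.isEmbedding.toHomeomorph.symm.isEmbedding.discreteTopology
  refine DiscreteTopology.of_subset hdiscrete ?_
  rw [omegaPeriods_eq_range hα.symm]
  rintro _ ⟨b, rfl⟩
  exact ⟨_, rfl⟩

end Periods

theorem mainTheorem3 (n : ℕ) :
    -- `[S¹, T^(2n)] ≅ ℤ^(2n)`, each class contains a smooth loop and is of the form `h e`
    Function.Bijective (linearClass : (Fin (2 * n) → ℤ) → FreeHomotopyClass (2 * n)) ∧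
    (∀ α : FreeHomotopyClass (2 * n), Nonempty (LoopComponent α) ∧
      ∃ (h : ℕ) (e : Fin (2 * n) → ℤ), IsPrimitiveDecomposition α h e) ∧
    -- the pairing of `ω_std` with `π₁(L_α)` is well defined
    (∀ (α : FreeHomotopyClass (2 * n)) (z : LoopComponent α)
      (A : FundamentalGroup (LoopComponent α) z),
      (∃ u : SmoothToroid (2 * n), u.Represents A) ∧
      ∀ u : SmoothToroid (2 * n), u.Represents A → u.integral = omegaBar A) ∧
    -- the set of values of `ω_std` on `π₁(L_α)`
    (∀ (α : FreeHomotopyClass (2 * n)) (z : LoopComponent α) (h : ℕ) (e : Fin (2 * n) → ℤ),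
      IsPrimitiveDecomposition α h e →
      omegaPeriods z =
        (h : ℝ) • {x : ℝ | ∃ b : Fin (2 * n) → ℤ,
          x = ((∑ i : Fin n,
            !![e (pIdx i), b (pIdx i); e (qIdx i), b (qIdx i)].det : ℤ) : ℝ)} ∧
      omegaPeriods z = (h : ℝ) • Set.range (fun c : ℤ => (c : ℝ))) ∧
    -- the values for iterated classes
    (∀ (α : FreeHomotopyClass (2 * n)) (k : ℕ) (z : LoopComponent α)
      (w : LoopComponent (iterateClass α k)),
      omegaPeriods w = (k : ℝ) • omegaPeriods z) ∧
    -- `ω_std` is `α`-toroidally rational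
    (∀ (α : FreeHomotopyClass (2 * n)) (z : LoopComponent α),
      DiscreteTopology (omegaPeriods z)) := by
  refine ⟨linearClass_bijective _,
    fun α => ⟨nonempty_loopComponent α, exists_isPrimitiveDecomposition α⟩,
    fun α z A => ⟨exists_represents A, fun u hu => hu.integral_eq_omegaBar⟩,
    fun α z h e H => ?_, fun α k z w => omegaPeriods_iterateClass z w,
    fun α z => discreteTopology_omegaPeriods z⟩
  have hperiods : omegaPeriods z = (h : ℝ) • Set.range fun b => ((omegaInt e b : ℤ) : ℝ) := by
    rw [omegaPeriods_eq_range H.1, range_omegaInt_smul]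
  refine ⟨hperiods.trans (congrArg _ ?_), hperiods.trans H.smul_range_omegaInt⟩
  exact Set.ext fun x => exists_congr fun b => eq_comm
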